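/- Let $(T,\mathcal G)$ be a Hausdorff topological space with Borel $\sigma$-algebra $\mathcal B$. A function $f:T\to\mathbb R$ is called symmetrizable (metasemicontinuous) if for every $\varepsilon>0$ there is a finite cover $(K_i)_{i\in I}$ of $T$ by sets of the form $K_i=G_i\cap F_i$, with $G_i$ open and $F_i$ closed, such that $\sup\{|f(s)-f(t)| : s,t\in K_i\}<\varepsilon$ for every $i\in I$ (the supremum over the empty set being $0$); $S(T,\mathcal G)$ denotes the space of all symmetrizable functions. A bounded Radon measure is a countably additive $\mu:\mathcal B\to\mathbb R$ such that for every $B\in\mathcal B$ and $\varepsilon>0$ there is a compact set $C\subset B$ with $|\mu(B)-\mu(C)|<\varepsilon$; $RM_b(T,\mathcal G)$ denotes the set of all of them and $RM_b(T,\mathcal G)_+$ the subset of those with $\mu\ge 0$. For $\mu\in RM_b(T,\mathcal G)$ with Jordan decomposition $\mu=\mu^+-\mu^-$ put $\int f\,d\mu=\int f\,d\mu^+-\int f\,d\mu^-$. The weak topology on $RM_b(T,\mathcal G)$ with respect to $S(T,\mathcal G)$ is the one in which every $\mu$ has as a base of neighbourhoods the sets $\{\nu : |\int f_k\,d\nu-\int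 f_k\,d\mu|<\varepsilon \text{ for } k=1,\dots,n\}$, with $\varepsilon>0$, $n\in\mathbb N$ and $f_1,\dots,f_n\in S(T,\mathcal G)$. Theorem ($S(T,\mathcal G)$-weak compactness criterion). Let $M\subset RM_b(T,\mathcal G)_+$, and let $\operatorname{cl}M$ be the closure of $M$ in $RM_b(T,\mathcal G)$ in the weak topology with respect to $S(T,\mathcal G)$. Then the following are equivalent: 1. $\operatorname{cl}M$ with the induced weak topology is compact (that is, Hausdorff and such that every open cover has a finite subcover); 2. $M$ has both of the following properties: - $(\alpha^\zeta)$ for every open $G\subset T$ and every $\varepsilon>0$ there is a compact set $C\subset G$ such that $\mu(G\setminus C)<\varepsilon$ for every $\mu\in M$; - $(\beta)$ there is a real number $b\ge 0$ such that $\mu(T)\le b$ for every $\mu\in M$. -/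

import Mathlib

open MeasureTheory Set
open scoped ENNReal

namespace RadonWeak

section Symmetrizable

variable {T : Type*}

/-- The oscillation `sup {|f s - f t| : s, t ∈ K}` of `f` on `K`, as an extended nonnegative real
(so that it is `∞` when `f` is unbounded on `K`, and `0` when `K` is empty). -/
noncomputable def oscillationOn (f : T → ℝ) (K : Set T) : ℝ≥0∞ :=
  ⨆ s ∈ K, ⨆ t ∈ K, ENNReal.ofReal |f s - f t|

theorem abs_sub_lt_of_oscillationOn_lt {f : T → ℝ} {K : Set T} {ε : ℝ} (hε : 0 < ε)
    (h : oscillationOn f K < ENNReal.ofReal ε) {s t : T} (hs : s ∈ K) (ht : t ∈ K) :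
    |f s - f t| < ε := by
  have h1 : ENNReal.ofReal |f s - f t| ≤ oscillationOn f K :=
    (le_iSup₂ (f := fun t (_ : t ∈ K) => ENNReal.ofReal |f s - f t|) t ht).trans
      (le_iSup₂ (f := fun s (_ : s ∈ K) => ⨆ t ∈ K, ENNReal.ofReal |f s - f t|) s hs)
  exact (ENNReal.ofReal_lt_ofReal_iff hε).1 (h1.trans_lt h)

variable [TopologicalSpace T]

/-- A symmetrizable (metasemicontinuous) function: for every `ε > 0` there is a finite cover of `T`
by sets of the form `G ∩ F`, with `G` open and `F` closed, on each of which `f` has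
oscillation `< ε`. -/
def IsSymmetrizable (f : T → ℝ) : Prop :=
  ∀ ε : ℝ, 0 < ε → ∃ 𝒦 : Set (Set T), 𝒦.Finite ∧
    (∀ K ∈ 𝒦, ∃ G F : Set T, IsOpen G ∧ IsClosed F ∧ K = G ∩ F) ∧
    ⋃₀ 𝒦 = univ ∧
    ∀ K ∈ 𝒦, oscillationOn f K < ENNReal.ofReal ε

variable (T) in
/-- The space `S(T, 𝒢)` of all symmetrizable functions on `T`. -/
def symmetrizableFunctions : Set (T → ℝ) := {f | IsSymmetrizable f}

theorem IsSymmetrizable.measurable [MeasurableSpace T] [BorelSpace T] {f : T → ℝ}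
    (hf : IsSymmetrizable f) : Measurable f := by
  refine measurable_of_Ioi fun a => ?_
  choose 𝒦 hfin hlc hcov hosc using fun n : ℕ =>
    hf (1 / ((n : ℝ) + 1)) Nat.one_div_pos_of_nat
  have key : f ⁻¹' Ioi a = ⋃ n, ⋃₀ {K | K ∈ 𝒦 n ∧ K ⊆ f ⁻¹' Ioi a} := by
    ext x
    simp only [mem_iUnion, mem_sUnion, mem_ofPred_eq]
    constructor
    · intro hx
      obtain ⟨n, hn⟩ := exists_nat_one_div_lt (sub_pos.2 (show a < f x from hx))
      obtain ⟨K, hK, hxK⟩ : x ∈ ⋃₀ 𝒦 n := by rw [hcov]; trivial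
      refine ⟨n, K, ⟨hK, fun y hy => ?_⟩, hxK⟩
      have := abs_sub_lt_of_oscillationOn_lt Nat.one_div_pos_of_nat (hosc n K hK) hxK hy
      have := (abs_lt.1 this).2
      show a < f y
      linarith
    · rintro ⟨n, K, ⟨-, hK⟩, hx⟩
      exact hK hx
  rw [key]
  refine MeasurableSet.iUnion fun n => MeasurableSet.sUnion
    ((hfin n).subset fun K hK => hK.1).countable ?_
  rintro K ⟨hK, -⟩
  obtain ⟨G, F, hG, hF, rfl⟩ := hlc n K hK
  exact hG.measurableSet.inter hF.measurableSet

theorem IsSymmetrizable.exists_bound {f : T → ℝ} (hf : IsSymmetrizable f) :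
    ∃ c, ∀ t, |f t| ≤ c := by
  obtain ⟨𝒦, hfin, -, hcov, hosc⟩ := hf 1 one_pos
  have hb : ∀ K ∈ 𝒦, BddAbove ((fun t => |f t|) '' K) := by
    intro K hK
    rcases K.eq_empty_or_nonempty with rfl | ⟨s, hs⟩
    · simp
    · refine ⟨|f s| + 1, ?_⟩
      rintro _ ⟨t, ht, rfl⟩
      have := abs_sub_lt_of_oscillationOn_lt one_pos (hosc K hK) ht hs
      have h2 := abs_sub_abs_le_abs_sub (f t) (f s)
      show |f t| ≤ _
      linarith
  obtain ⟨c, hc⟩ := (hfin.bddAbove_biUnion (S := fun K => (fun t => |f t|) '' K)).2 hb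
  refine ⟨c, fun t => hc ?_⟩
  obtain ⟨K, hK, htK⟩ : t ∈ ⋃₀ 𝒦 := by rw [hcov]; trivial
  exact mem_biUnion hK ⟨t, htK, rfl⟩

/-- Symmetrizable functions are integrable with respect to every finite Borel measure, so the
integrals below are never junk values. -/
theorem IsSymmetrizable.integrable [MeasurableSpace T] [BorelSpace T] {f : T → ℝ}
    (hf : IsSymmetrizable f) (μ : Measure T) [IsFiniteMeasure μ] : Integrable f μ := by
  obtain ⟨c, hc⟩ := hf.exists_bound
  exact Integrable.of_bound hf.measurable.aestronglyMeasurable c (ae_of_all _ hc)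

end Symmetrizable

section Radon

variable (T : Type*) [TopologicalSpace T] [MeasurableSpace T]

/-- The set `RM_b(T, 𝒢)` of bounded Radon measures: (real-valued, countably additive, possibly
signed) measures on the (Borel) σ-algebra that are inner compactly regular. -/
def BoundedRadonMeasure : Type _ :=
  {μ : SignedMeasure T // ∀ B : Set T, MeasurableSet B → ∀ ε : ℝ, 0 < ε →
    ∃ C : Set T, IsCompact C ∧ C ⊆ B ∧ |μ B - μ C| < ε}

variable {T}

namespace BoundedRadonMeasure

/-- The underlying signed measure. -/
def toSigned (μ : BoundedRadonMeasure T) : SignedMeasure T := μ.1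

/-- The Lebesgue integral `∫ f dμ = ∫ f dμ⁺ - ∫ f dμ⁻`, where `μ = μ⁺ - μ⁻` is the Jordan (Riesz)
decomposition of `μ`. -/
noncomputable def integral (μ : BoundedRadonMeasure T) (f : T → ℝ) : ℝ :=
  ∫ t, f t ∂μ.toSigned.toJordanDecomposition.posPart -
    ∫ t, f t ∂μ.toSigned.toJordanDecomposition.negPart

end BoundedRadonMeasure

variable (T) in
/-- The set `RM_b(T, 𝒢)₊` of positive bounded Radon measures. -/
def positiveRadonMeasures : Set (BoundedRadonMeasure T) :=
  {μ | ∀ B : Set T, MeasurableSet B → 0 ≤ μ.toSigned B}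

/-- The weak topology on `RM_b(T, 𝒢)` with respect to `S(T, 𝒢)`: the coarsest topology for which
`μ ↦ ∫ f dμ` is continuous for every symmetrizable `f`. -/
noncomputable instance weakTopology : TopologicalSpace (BoundedRadonMeasure T) :=
  TopologicalSpace.induced
    (fun μ (f : symmetrizableFunctions T) => μ.integral f) Pi.topologicalSpace

/-- The sets `{ν | ∀ f ∈ A, |∫ f dν - ∫ f dμ| < ε}`, with `A` a finite set of symmetrizable
functions and `ε > 0`, form a base of neighbourhoods of `μ` in the weak topology. -/
theorem mem_nhds_iff_weak (μ : BoundedRadonMeasure T) (U : Set (BoundedRadonMeasure T)) :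
    U ∈ nhds μ ↔ ∃ A : Finset (T → ℝ), (∀ f ∈ A, IsSymmetrizable f) ∧ ∃ ε : ℝ, 0 < ε ∧
      {ν : BoundedRadonMeasure T | ∀ f ∈ A, |ν.integral f - μ.integral f| < ε} ⊆ U := by
  classical
  rw [nhds_induced, Filter.mem_comap]
  constructor
  · rintro ⟨V, hV, hVU⟩
    rw [nhds_pi, Filter.mem_pi] at hV
    obtain ⟨I, hI, t, ht, htV⟩ := hV
    choose r hr hrt using fun f => Metric.mem_nhds_iff.1 (ht f)
    obtain ⟨ε, hε, hεr⟩ : ∃ ε : ℝ, 0 < ε ∧ ∀ f ∈ I, ε ≤ r f := by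
      rcases I.eq_empty_or_nonempty with rfl | hne
      · exact ⟨1, one_pos, by simp⟩
      · obtain ⟨g, -, hg⟩ := hI.exists_minimalFor r I hne
        refine ⟨r g, hr g, fun f hf => ?_⟩
        rcases le_total (r g) (r f) with h | h
        · exact h
        · exact hg hf h
    refine ⟨hI.toFinset.image Subtype.val, ?_, ε, hε, fun ν hν => hVU (htV fun f hf => hrt f ?_)⟩
    · intro f hf
      obtain ⟨g, -, rfl⟩ := Finset.mem_image.1 hf
      exact g.2
    · rw [Metric.mem_ball, Real.dist_eq]
      exact (hν f.1 (Finset.mem_image_of_mem _ (hI.mem_toFinset.2 hf))).trans_le (hεr f hf)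
  · rintro ⟨A, hA, ε, hε, hU⟩
    refine ⟨(Subtype.val ⁻¹' (A : Set (T → ℝ))).pi fun f => Metric.ball (μ.integral f) ε,
      set_pi_mem_nhds (A.finite_toSet.preimage Subtype.val_injective.injOn)
        fun f _ => Metric.ball_mem_nhds _ hε, fun ν hν => hU fun f hf => ?_⟩
    have := hν ⟨f, hA f hf⟩ hf
    rwa [Metric.mem_ball, Real.dist_eq] at this

/-- The locally-uniform tightness property `(α^ζ)`. -/
def LocallyUniformlyTight (M : Set (BoundedRadonMeasure T)) : Prop :=
  ∀ G : Set T, IsOpen G → ∀ ε : ℝ, 0 < ε →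
    ∃ C : Set T, IsCompact C ∧ C ⊆ G ∧ ∀ μ ∈ M, μ.toSigned (G \ C) < ε

/-- Property `(β)`: the total masses `μ T`, `μ ∈ M`, are bounded above (for positive measures, and
`M` nonempty, `sup {μ T : μ ∈ M}` is a nonnegative real number). -/
def UniformlyBoundedMass (M : Set (BoundedRadonMeasure T)) : Prop :=
  ∃ b : ℝ, 0 ≤ b ∧ ∀ μ ∈ M, μ.toSigned univ ≤ b

end Radon

end RadonWeak

/-! A symmetrizable function is a uniform limit of linear combinations of indicators of open sets,
so a filter of positive measures converges weakly to a positive measure as soon as it converges on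
every open set.

Sufficiency: along an ultrafilter on the closure of M, mass boundedness makes every ν(B) converge,
to F(B) say. F is finitely additive, and tightness passes to the limit, so F is inner compactly
regular on open sets. The content K ↦ F(K) on compacts then yields a regular measure equal to F on
open sets (`exists_regular_measure_eq_on_open`), which is the weak limit.

Necessity: evaluation at open sets is continuous, which bounds the masses. If tightness failed for G
and ε, the compact sets {μ | μ(G \ C) ≥ ε} would be nonempty and directed downwards as C grows, so
some μ would lie in all of them, against its own inner regularity. -/

open Filter Topology TopologicalSpace

namespace RadonWeak

open scoped NNReal

/-! ### Uniform approximation of symmetrizable functions by combinations of indicators of open sets.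
-/

section Approximation

variable {T : Type*}

theorem oscillationOn_eq_zero {f : T → ℝ} {K : Set T} (h : ∀ s ∈ K, ∀ t ∈ K, f s = f t) :
    oscillationOn f K = 0 := by
  simp only [oscillationOn, ENNReal.iSup_eq_zero]
  intro s hs t ht
  simp [h s hs t ht]

theorem abs_integral_sub_integral_le [MeasurableSpace T] {m : Measure T} [IsFiniteMeasure m]
    {f g : T → ℝ} {ε : ℝ}
    (hf : Integrable f m) (hg : Integrable g m) (h : ∀ t, |f t - g t| < ε) :
    |∫ t, f t ∂m - ∫ t, g t ∂m| ≤ ε * m.real univ := by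
  rw [← integral_sub hf hg]
  exact norm_integral_le_of_norm_le_const (f := fun t => f t - g t)
    (ae_of_all _ fun t => (h t).le)

variable [TopologicalSpace T]

theorem isSymmetrizable_indicator {G : Set T} (hG : IsOpen G) :
    IsSymmetrizable (G.indicator (1 : T → ℝ)) := by
  intro ε hε
  refine ⟨{G, Gᶜ}, by simp, ?_, by simp, ?_⟩
  · rintro K (rfl | rfl)
    · exact ⟨K, univ, hG, isClosed_univ, by simp⟩
    · exact ⟨univ, Gᶜ, isOpen_univ, hG.isClosed_compl, by simp⟩
  · rintro K (rfl | rfl) <;> rw [oscillationOn_eq_zero]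
    · simpa using hε
    · intro s hs t ht
      simp [hs, ht]
    · simpa using hε
    · intro s hs t ht
      rw [indicator_of_notMem hs, indicator_of_notMem ht]

variable (T) in
/-- The indicators of open sets, as a submonoid of the functions on `T`. -/
def openIndicators : Submonoid (T → ℝ) where
  carrier := {g | ∃ G : Set T, IsOpen G ∧ g = G.indicator 1}
  one_mem' := ⟨univ, isOpen_univ, by simp⟩
  mul_mem' := by
    rintro _ _ ⟨G, hG, rfl⟩ ⟨H, hH, rfl⟩
    exact ⟨G ∩ H, hG.inter hH, by rw [inter_indicator_one]⟩

variable (T) in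
/-- The algebra generated by the indicators of open sets. -/
def openAlgebra : Subalgebra ℝ (T → ℝ) := Algebra.adjoin ℝ (openIndicators T : Set (T → ℝ))

theorem indicator_mem_openAlgebra {G : Set T} (hG : IsOpen G) :
    G.indicator (1 : T → ℝ) ∈ openAlgebra T :=
  Algebra.subset_adjoin ⟨G, hG, rfl⟩

theorem indicator_inter_mem_openAlgebra {G F : Set T} (hG : IsOpen G) (hF : IsClosed F) :
    (G ∩ F).indicator (1 : T → ℝ) ∈ openAlgebra T := by
  have : (G ∩ F).indicator (1 : T → ℝ) = G.indicator 1 * (1 - Fᶜ.indicator 1) := by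
    rw [inter_indicator_one, indicator_compl, sub_sub_cancel]
  rw [this]
  exact mul_mem (indicator_mem_openAlgebra hG)
    (sub_mem (one_mem _) (indicator_mem_openAlgebra hF.isOpen_compl))

/-- No case for products is needed: the generators form a monoid, since open sets are stable under
intersection, so the algebra is their linear span. -/
theorem openAlgebra_induction {p : (T → ℝ) → Prop}
    (indicator : ∀ G : Set T, IsOpen G → p (G.indicator 1)) (zero : p 0)
    (add : ∀ f g, p f → p g → p (f + g)) (smul : ∀ (c : ℝ) f, p f → p (c • f))
    {g : T → ℝ} (hg : g ∈ openAlgebra T) : p g := by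
  rw [openAlgebra, ← Subalgebra.mem_toSubmodule, Algebra.adjoin_eq_span,
    Submonoid.closure_eq] at hg
  induction hg using Submodule.span_induction with
  | mem x h =>
    obtain ⟨G, hG, rfl⟩ := h
    exact indicator G hG
  | zero => exact zero
  | add x y _ _ hx hy => exact add x y hx hy
  | smul c x _ hx => exact smul c x hx

/-- Induction on the cover: each new piece K overwrites the approximant on K by a value of `f`
there. The pieces may overlap, and the algebra absorbs the overwriting. -/
theorem IsSymmetrizable.exists_openAlgebra_approx {f : T → ℝ} (hf : IsSymmetrizable f) {ε : ℝ}
    (hε : 0 < ε) : ∃ g ∈ openAlgebra T, ∀ t, |f t - g t| < ε := by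
  obtain ⟨𝒦, hfin, hlc, hcov, hosc⟩ := hf ε hε
  suffices h : ∃ g ∈ openAlgebra T, ∀ t ∈ ⋃₀ 𝒦, |f t - g t| < ε by simpa [hcov] using h
  clear hcov
  induction 𝒦, hfin using Set.Finite.induction_on with
  | empty => exact ⟨0, zero_mem _, by simp⟩
  | @insert K 𝒦 _ _ ih =>
    obtain ⟨g, hg, hfg⟩ := ih (fun L hL => hlc L (mem_insert_of_mem _ hL))
      fun L hL => hosc L (mem_insert_of_mem _ hL)
    rcases K.eq_empty_or_nonempty with rfl | ⟨s, hs⟩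
    · exact ⟨g, hg, by simpa using hfg⟩
    obtain ⟨G, F, hG, hF, hK⟩ := hlc K (mem_insert _ _)
    have hKA : K.indicator (1 : T → ℝ) ∈ openAlgebra T := by
      rw [hK]; exact indicator_inter_mem_openAlgebra hG hF
    refine ⟨f s • K.indicator 1 + (1 - K.indicator 1) * g,
      add_mem (Subalgebra.smul_mem _ hKA _) (mul_mem (sub_mem (one_mem _) hKA) hg), ?_⟩
    rw [sUnion_insert]
    intro t ht
    by_cases htK : t ∈ K
    · simpa [htK] using abs_sub_lt_of_oscillationOn_lt hε (hosc K (mem_insert _ _)) htK hs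
    · simpa [htK] using hfg t (ht.resolve_left htK)

variable [MeasurableSpace T] [BorelSpace T]

theorem tendsto_integral_of_mem_openAlgebra {ι : Type*} {l : Filter ι} {m : ι → Measure T}
    [∀ i, IsFiniteMeasure (m i)] {m₀ : Measure T} [IsFiniteMeasure m₀]
    (h : ∀ G : Set T, IsOpen G → Tendsto (fun i => (m i).real G) l (𝓝 (m₀.real G)))
    {g : T → ℝ} (hg : g ∈ openAlgebra T) :
    (∀ i, Integrable g (m i)) ∧ Integrable g m₀ ∧
      Tendsto (fun i => ∫ t, g t ∂m i) l (𝓝 (∫ t, g t ∂m₀)) := by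
  refine openAlgebra_induction
    (p := fun g => (∀ i, Integrable g (m i)) ∧ Integrable g m₀ ∧
      Tendsto (fun i => ∫ t, g t ∂m i) l (𝓝 (∫ t, g t ∂m₀)))
    (fun G hG => ⟨fun i => (isSymmetrizable_indicator hG).integrable _,
      (isSymmetrizable_indicator hG).integrable _, ?_⟩) (by simp [tendsto_const_nhds])
    (fun f g hf hg => ⟨fun i => (hf.1 i).add (hg.1 i), hf.2.1.add hg.2.1, ?_⟩)
    (fun c f hf => ⟨fun i => (hf.1 i).smul c, hf.2.1.smul c, ?_⟩) hg
  · simpa only [integral_indicator_one hG.measurableSet] using h G hG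
  · simp only [Pi.add_apply, integral_add (hf.1 _) (hg.1 _), integral_add hf.2.1 hg.2.1]
    exact hf.2.2.add hg.2.2
  · simp only [Pi.smul_apply, integral_smul]
    exact hf.2.2.const_smul c

theorem tendsto_integral_of_tendsto_open {ι : Type*} {l : Filter ι} {m : ι → Measure T}
    [∀ i, IsFiniteMeasure (m i)] {m₀ : Measure T} [IsFiniteMeasure m₀]
    (h : ∀ G : Set T, IsOpen G → Tendsto (fun i => (m i).real G) l (𝓝 (m₀.real G)))
    {f : T → ℝ} (hf : IsSymmetrizable f) :
    Tendsto (fun i => ∫ t, f t ∂m i) l (𝓝 (∫ t, f t ∂m₀)) := by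
  rw [Metric.tendsto_nhds]
  intro ε hε
  -- As `univ` is open, the masses of the `m i` are eventually below this `b`; no uniform bound has
  -- to be assumed. The tolerance ε/(3b) then costs at most ε/3 under each measure.
  set b := m₀.real univ + 1 with hb
  have hb0 : 0 < b := by positivity
  obtain ⟨g, hg, hfg⟩ := hf.exists_openAlgebra_approx (ε := ε / (3 * b)) (by positivity)
  obtain ⟨hgi, hg0, hgt⟩ := tendsto_integral_of_mem_openAlgebra h hg
  have key : ∀ n : Measure T, IsFiniteMeasure n → Integrable g n → n.real univ < b →
      |∫ t, f t ∂n - ∫ t, g t ∂n| ≤ ε / 3 := by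
    intro n _ hn hnb
    refine (abs_integral_sub_integral_le (hf.integrable n) hn hfg).trans ?_
    calc ε / (3 * b) * n.real univ ≤ ε / (3 * b) * b := by gcongr
      _ = ε / 3 := by field_simp
  filter_upwards [Metric.tendsto_nhds.1 hgt (ε / 3) (by positivity),
    (h univ isOpen_univ).eventually_lt_const (lt_add_one _)] with i hi hib
  have h1 := abs_le.1 (key (m i) inferInstance (hgi i) hib)
  have h2 := abs_le.1 (key m₀ inferInstance hg0 (lt_add_one _))
  rw [Real.dist_eq, abs_lt] at hi ⊢
  constructor <;> linarith [h1.1, h1.2, h2.1, h2.2, hi.1, hi.2]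

end Approximation

/-! ### From finitely additive set functions to regular measures. -/

section Content

variable {T : Type*} [TopologicalSpace T] [T2Space T] [MeasurableSpace T] [BorelSpace T]

/-- A finitely additive set function on the Borel sets that is inner compactly regular on open sets
agrees on the open sets with a finite regular measure. -/
theorem exists_regular_measure_eq_on_open (F : Set T → ℝ≥0)
    (hadd : ∀ A B, MeasurableSet A → MeasurableSet B → Disjoint A B → F (A ∪ B) = F A + F B)
    (htight : ∀ G, IsOpen G → ∀ ε : ℝ≥0, 0 < ε → ∃ C, IsCompact C ∧ C ⊆ G ∧ F G ≤ F C + ε) :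
    ∃ μ : Measure T, IsFiniteMeasure μ ∧ μ.Regular ∧ ∀ G, IsOpen G → μ G = F G := by
  have hmono : ∀ A B, MeasurableSet A → MeasurableSet B → A ⊆ B → F A ≤ F B := by
    intro A B hA hB hAB
    have := hadd A (B \ A) hA (hB.diff hA) disjoint_sdiff_right
    rw [union_sdiff_cancel hAB] at this
    simp [this]
  -- Only the values of `F` on compacts enter, so the resulting measure may differ from `F` on Borel
  -- sets that are not open.
  let κ : Content T :=
    { toFun := fun K => F K
      mono' := fun K L h => hmono _ _ K.isCompact.measurableSet L.isCompact.measurableSet h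
      sup_disjoint' := fun K L h _ _ => by
        rw [Compacts.coe_sup]
        exact hadd _ _ K.isCompact.measurableSet L.isCompact.measurableSet h
      sup_le' := fun K L => by
        have hK := K.isCompact.measurableSet
        have hL := L.isCompact.measurableSet
        rw [Compacts.coe_sup, ← union_sdiff_self, hadd _ _ hK (hL.diff hK) disjoint_sdiff_right]
        gcongr
        exact hmono _ _ (hL.diff hK) hL sdiff_subset }
  -- On an open set the measure is the supremum of `F` over compact subsets: monotonicity bounds it
  -- above by `F G`, tightness below.
  have hopen : ∀ G, IsOpen G → κ.measure G = F G := by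
    intro G hG
    rw [κ.measure_apply hG.measurableSet, κ.outerMeasure_of_isOpen G hG]
    apply le_antisymm
    · refine iSup₂_le fun K hK => ?_
      exact ENNReal.coe_le_coe.2 (hmono _ _ K.isCompact.measurableSet hG.measurableSet hK)
    · refine ENNReal.le_of_forall_pos_le_add fun ε hε _ => ?_
      obtain ⟨C, hC, hCG, hle⟩ := htight G hG ε hε
      refine (ENNReal.coe_le_coe.2 hle).trans ?_
      rw [ENNReal.coe_add]
      gcongr
      exact κ.le_innerContent ⟨C, hC⟩ ⟨G, hG⟩ hCG
  have hfin : IsFiniteMeasure κ.measure := ⟨by simp [hopen univ isOpen_univ]⟩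
  refine ⟨κ.measure, hfin, ⟨?_⟩, hopen⟩
  intro G hG r hr
  rw [κ.measure_apply hG.measurableSet, κ.outerMeasure_of_isOpen G hG] at hr
  obtain ⟨K, hK⟩ := lt_iSup_iff.1 hr
  obtain ⟨hKG, hrK⟩ := lt_iSup_iff.1 hK
  refine ⟨K, hKG, K.isCompact, hrK.trans_le ?_⟩
  rw [κ.measure_apply K.isCompact.measurableSet]
  exact κ.le_outerMeasure_compacts K

end Content

/-! ### Continuity of evaluations, separation and positivity in the weak topology. -/

namespace BoundedRadonMeasure

variable {T : Type*} [TopologicalSpace T] [MeasurableSpace T]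

theorem continuous_integral {f : T → ℝ} (hf : IsSymmetrizable f) :
    Continuous fun μ : BoundedRadonMeasure T => μ.integral f :=
  (continuous_apply (A := fun _ : symmetrizableFunctions T => ℝ) ⟨f, hf⟩).comp
    (continuous_induced_dom (f := fun (μ : BoundedRadonMeasure T)
      (g : symmetrizableFunctions T) => μ.integral g))

theorem tendsto_nhds_iff {ι : Type*} {l : Filter ι} {ν : ι → BoundedRadonMeasure T}
    {μ : BoundedRadonMeasure T} :
    Tendsto ν l (𝓝 μ) ↔
      ∀ f, IsSymmetrizable f → Tendsto (fun i => (ν i).integral f) l (𝓝 (μ.integral f)) := by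
  rw [nhds_induced, tendsto_comap_iff, tendsto_pi_nhds]
  exact ⟨fun h f hf => h ⟨f, hf⟩, fun h f => h f.1 f.2⟩

theorem integral_indicator_one (μ : BoundedRadonMeasure T) {B : Set T} (hB : MeasurableSet B) :
    μ.integral (B.indicator 1) = μ.toSigned B := by
  rw [integral, MeasureTheory.integral_indicator_one hB, MeasureTheory.integral_indicator_one hB,
    SignedMeasure.apply_eq_posPart_real_sub_negPart_real _ hB]

theorem exists_measure_of_nonneg {μ : BoundedRadonMeasure T} (hμ : μ ∈ positiveRadonMeasures T) :
    ∃ m : Measure T, IsFiniteMeasure m ∧ (∀ B, MeasurableSet B → μ.toSigned B = m.real B) ∧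
      ∀ f, μ.integral f = ∫ t, f t ∂m := by
  have h0 : 0 ≤[univ] μ.toSigned := by
    rw [VectorMeasure.restrict_univ, VectorMeasure.restrict_univ]
    exact fun B hB => hμ B hB
  let m := μ.toSigned.toMeasureOfZeroLE univ MeasurableSet.univ h0
  have hm : m.toSignedMeasure = μ.toSigned := SignedMeasure.toMeasureOfZeroLE_toSignedMeasure _ h0
  let j : JordanDecomposition T := ⟨m, 0, Measure.MutuallySingular.zero_right⟩
  have hj : μ.toSigned.toJordanDecomposition = j :=
    SignedMeasure.toJordanDecomposition_eq <| by
      simp [JordanDecomposition.toSignedMeasure, j, hm]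
  refine ⟨m, inferInstance, fun B hB => ?_, fun f => ?_⟩
  · rw [← hm, Measure.toSignedMeasure_apply_measurable hB]
  · simp [integral, hj, j]

theorem toSigned_diff (μ : BoundedRadonMeasure T) {A B : Set T} (hA : MeasurableSet A)
    (hB : MeasurableSet B) (h : A ⊆ B) : μ.toSigned (B \ A) = μ.toSigned B - μ.toSigned A := by
  rw [eq_sub_iff_add_eq', VectorMeasure.of_add_of_sdiff hA hB h]

variable [BorelSpace T]

theorem continuous_apply_of_isOpen {G : Set T} (hG : IsOpen G) :
    Continuous fun μ : BoundedRadonMeasure T => μ.toSigned G := by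
  simpa only [integral_indicator_one _ hG.measurableSet] using
    continuous_integral (isSymmetrizable_indicator hG)

theorem continuous_apply_of_isClosed {F : Set T} (hF : IsClosed F) :
    Continuous fun μ : BoundedRadonMeasure T => μ.toSigned F := by
  have h : ∀ μ : BoundedRadonMeasure T, μ.toSigned F = μ.toSigned univ - μ.toSigned Fᶜ := by
    intro μ
    rw [← toSigned_diff μ hF.measurableSet.compl MeasurableSet.univ (subset_univ _)]
    simp
  simp only [h]
  exact (continuous_apply_of_isOpen isOpen_univ).sub
    (continuous_apply_of_isOpen hF.isOpen_compl)

/-- Open sets are a π-system generating the Borel sets. Uniqueness on a π-system is for positive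
measures, so the negative parts are moved across: μ⁺ + ν⁻ is compared with ν⁺ + μ⁻. -/
theorem ext_of_isOpen {μ ν : BoundedRadonMeasure T}
    (h : ∀ G, IsOpen G → μ.toSigned G = ν.toSigned G) : μ = ν := by
  set p := μ.toSigned.toJordanDecomposition with hp
  set q := ν.toSigned.toJordanDecomposition with hq
  have key : ∀ B, MeasurableSet B → (μ.toSigned B = ν.toSigned B ↔
      (p.posPart + q.negPart) B = (q.posPart + p.negPart) B) := by
    intro B hB
    rw [← measureReal_eq_measureReal_iff, measureReal_add_apply, measureReal_add_apply,
      SignedMeasure.apply_eq_posPart_real_sub_negPart_real _ hB,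
      SignedMeasure.apply_eq_posPart_real_sub_negPart_real _ hB]
    constructor <;> intro h <;> linarith
  have hpq : p.posPart + q.negPart = q.posPart + p.negPart := by
    refine ext_of_generate_finite {G | IsOpen G} (BorelSpace.measurable_eq (α := T))
      isPiSystem_isOpen (fun G hG => (key G hG.measurableSet).1 (h G hG)) ?_
    exact (key univ MeasurableSet.univ).1 (h univ isOpen_univ)
  refine Subtype.ext (VectorMeasure.ext fun B hB => ?_)
  exact (key B hB).2 (by rw [hpq])

instance : T2Space (BoundedRadonMeasure T) := by
  refine ⟨fun μ ν hne => ?_⟩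
  obtain ⟨G, hG, hGne⟩ : ∃ G, IsOpen G ∧ μ.toSigned G ≠ ν.toSigned G := by
    by_contra! h
    exact hne (ext_of_isOpen h)
  exact separated_by_continuous (continuous_apply_of_isOpen hG) hGne

variable [T2Space T]

/-- By inner regularity, positivity need only be tested on compacts; these are closed, so each test
is a closed condition. -/
theorem isClosed_positiveRadonMeasures : IsClosed (positiveRadonMeasures T) := by
  have : positiveRadonMeasures T = ⋂ (C : Set T) (_ : IsCompact C), {μ | 0 ≤ μ.toSigned C} := by
    ext μ
    simp only [mem_iInter, mem_ofPred_eq, positiveRadonMeasures]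
    refine ⟨fun h C hC => h C hC.measurableSet, fun h B hB => ?_⟩
    refine le_of_forall_pos_lt_add fun ε hε => ?_
    obtain ⟨C, hC, -, hlt⟩ := μ.2 B hB ε hε
    have := (abs_lt.1 hlt).1
    have h2 := h C hC
    simp only [toSigned] at h2 ⊢
    linarith
  rw [this]
  exact isClosed_biInter fun C (hC : IsCompact C) =>
    isClosed_le continuous_const (continuous_apply_of_isClosed hC.isClosed)

/-- A finite regular measure, as a bounded Radon measure. -/
noncomputable def ofMeasure (m : Measure T) [IsFiniteMeasure m] [m.Regular] :
    BoundedRadonMeasure T :=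
  ⟨m.toSignedMeasure, fun B hB ε hε => by
    obtain ⟨C, hCB, hC, hlt⟩ := hB.exists_isCompact_sdiff_lt (μ := m) (measure_ne_top m B)
      (ε := ENNReal.ofReal ε) (by simpa using hε)
    refine ⟨C, hC, hCB, ?_⟩
    rw [Measure.toSignedMeasure_apply_measurable hB,
      Measure.toSignedMeasure_apply_measurable hC.measurableSet,
      ← measureReal_sdiff hCB hC.measurableSet, abs_of_nonneg measureReal_nonneg]
    exact ENNReal.toReal_lt_of_lt_ofReal hlt⟩

theorem integral_ofMeasure (m : Measure T) [IsFiniteMeasure m] [m.Regular] (f : T → ℝ) :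
    (ofMeasure m).integral f = ∫ t, f t ∂m := by
  have hj : (ofMeasure m).toSigned.toJordanDecomposition =
      ⟨m, 0, Measure.MutuallySingular.zero_right⟩ :=
    SignedMeasure.toJordanDecomposition_eq <| by
      simp [JordanDecomposition.toSignedMeasure, ofMeasure, toSigned]
  simp [integral, hj]

end BoundedRadonMeasure

/-! ### Compactness against tightness and bounded mass. -/

section Compactness

open BoundedRadonMeasure

variable {T : Type*} [TopologicalSpace T] [MeasurableSpace T] [BorelSpace T]
  {M : Set (BoundedRadonMeasure T)}

theorem UniformlyBoundedMass.closure (h : UniformlyBoundedMass M) :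
    UniformlyBoundedMass (closure M) := by
  obtain ⟨b, hb, hle⟩ := h
  exact ⟨b, hb, closure_minimal (t := {μ : BoundedRadonMeasure T | μ.toSigned univ ≤ b}) hle
    (isClosed_le (continuous_apply_of_isOpen isOpen_univ) continuous_const)⟩

theorem uniformlyBoundedMass_of_isCompact (hM : IsCompact M) : UniformlyBoundedMass M := by
  obtain ⟨b, hb⟩ := hM.bddAbove_image (continuous_apply_of_isOpen isOpen_univ).continuousOn
  exact ⟨max b 0, le_max_right _ _, fun μ hμ => (hb ⟨μ, hμ, rfl⟩).trans (le_max_left _ _)⟩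

variable [T2Space T]

theorem LocallyUniformlyTight.closure (h : LocallyUniformlyTight M) :
    LocallyUniformlyTight (closure M) := by
  intro G hG ε hε
  -- The closure preserves only the non-strict inequality; halving ε restores strictness.
  obtain ⟨C, hC, hCG, hlt⟩ := h G hG (ε / 2) (half_pos hε)
  refine ⟨C, hC, hCG, fun μ hμ => (?_ : μ.toSigned (G \ C) ≤ ε / 2).trans_lt (half_lt_self hε)⟩
  exact closure_minimal (t := {μ : BoundedRadonMeasure T | μ.toSigned (G \ C) ≤ ε / 2})
    (fun ν hν => (hlt ν hν).le)
    (isClosed_le (continuous_apply_of_isOpen (hG.sdiff hC.isClosed)) continuous_const) hμ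

theorem isCompact_of_isClosed_of_tight (hM : M ⊆ positiveRadonMeasures T) (hcl : IsClosed M)
    (ht : LocallyUniformlyTight M) (hb : UniformlyBoundedMass M) : IsCompact M := by
  rw [isCompact_iff_ultrafilter_le_nhds]
  intro U hU
  have hUM : ∀ᶠ ν in (U : Filter (BoundedRadonMeasure T)), ν ∈ M := le_principal_iff.1 hU
  obtain ⟨b, hb0, hb⟩ := hb
  have hIcc : ∀ ν ∈ M, ∀ B : Set T, ν.toSigned B ∈ Icc 0 b := by
    intro ν hν B
    by_cases hB : MeasurableSet B
    · have h1 := hM hν _ (MeasurableSet.univ.diff hB)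
      rw [toSigned_diff ν hB MeasurableSet.univ (subset_univ _)] at h1
      exact ⟨hM hν B hB, by linarith [hb ν hν]⟩
    -- A signed measure is 0 by convention off the σ-algebra, so the limit `F` below exists for
    -- every set.
    · rw [VectorMeasure.not_measurable _ hB]
      exact ⟨le_rfl, hb0⟩
  -- Each ν ↦ ν(B) pushes the ultrafilter to one on the compact interval [0, b], where it converges.
  have hlim : ∀ B : Set T, ∃ x ∈ Icc 0 b,
      Tendsto (fun ν : BoundedRadonMeasure T => ν.toSigned B) U (𝓝 x) := fun B =>
    isCompact_iff_ultrafilter_le_nhds.1 isCompact_Icc (U.map fun ν => ν.toSigned B)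
      (tendsto_principal.2 (hUM.mono fun ν hν => hIcc ν hν B))
  choose F hF0 hF using hlim
  have hadd : ∀ A B, MeasurableSet A → MeasurableSet B → Disjoint A B →
      F (A ∪ B) = F A + F B := by
    intro A B hA hB hAB
    refine tendsto_nhds_unique (hF (A ∪ B)) (((hF A).add (hF B)).congr fun ν => ?_)
    rw [VectorMeasure.of_union hAB hA hB]
  obtain ⟨m, _, _, hm⟩ := exists_regular_measure_eq_on_open (fun B => (F B).toNNReal)
    (fun A B hA hB hAB => by
      rw [hadd A B hA hB hAB, Real.toNNReal_add (hF0 A).1 (hF0 B).1]) <| by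
    intro G hG ε hε
    obtain ⟨C, hC, hCG, hlt⟩ := ht G hG ε hε
    refine ⟨C, hC, hCG, ?_⟩
    have h1 : F (G \ C) ≤ ε :=
      le_of_tendsto (hF (G \ C)) (hUM.mono fun ν hν => (hlt ν hν).le)
    have h2 := hadd C (G \ C) hC.measurableSet (hG.measurableSet.diff hC.measurableSet)
      disjoint_sdiff_right
    rw [union_sdiff_cancel hCG] at h2
    rw [Real.toNNReal_le_iff_le_coe, NNReal.coe_add, Real.coe_toNNReal _ (hF0 C).1]
    linarith
  have hconv : (U : Filter (BoundedRadonMeasure T)) ≤ 𝓝 (ofMeasure m) := by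
    choose! n hnfin hn hni using
      fun (ν : BoundedRadonMeasure T) (hν : ν ∈ positiveRadonMeasures T) =>
        exists_measure_of_nonneg hν
    let n' : positiveRadonMeasures T → Measure T := fun ν => n ν
    have : ∀ ν, IsFiniteMeasure (n' ν) := fun ν => hnfin ν ν.2
    have hUP : ∀ᶠ ν in (U : Filter (BoundedRadonMeasure T)), ν ∈ positiveRadonMeasures T :=
      hUM.mono hM
    -- The convergence lemma wants a finite measure at every index, so `U` is pulled back to the
    -- positive measures, which belong to it.
    have hmap : map ((↑) : positiveRadonMeasures T → BoundedRadonMeasure T)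
        (comap (↑) (U : Filter (BoundedRadonMeasure T))) = U :=
      map_comap_of_mem (by simpa using hUP)
    rw [← hmap]
    refine tendsto_nhds_iff.2 fun f hf => ?_
    rw [integral_ofMeasure]
    refine (tendsto_integral_of_tendsto_open (m := n') (fun G hG => ?_) hf).congr
      fun ν => (hni ν ν.2 f).symm
    rw [measureReal_def, hm G hG, ENNReal.coe_toReal, Real.coe_toNNReal _ (hF0 G).1]
    exact ((hF G).comp tendsto_comap).congr fun ν => hn ν ν.2 G hG.measurableSet
  exact ⟨ofMeasure m, hcl.mem_of_tendsto hconv hUM, hconv⟩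

/-- A Dini-type argument: μ(G \ C) decreases as C grows and has infimum 0 for each μ by inner
regularity; compactness makes this uniform over `M`. -/
theorem locallyUniformlyTight_of_isCompact (hM : M ⊆ positiveRadonMeasures T) (hc : IsCompact M) :
    LocallyUniformlyTight M := by
  intro G hG ε hε
  by_contra! h
  let S := {C : Set T // IsCompact C ∧ C ⊆ G}
  have : Nonempty S := ⟨⟨∅, isCompact_empty, empty_subset _⟩⟩
  let Z : S → Set (BoundedRadonMeasure T) := fun C => M ∩ {μ | ε ≤ μ.toSigned (G \ C.1)}
  have hcompact : ∀ C, IsCompact (Z C) := fun C => hc.inter_right <|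
    isClosed_le continuous_const (continuous_apply_of_isOpen (hG.sdiff C.2.1.isClosed))
  have hanti : ∀ C D : S, C.1 ⊆ D.1 → Z D ⊆ Z C := by
    rintro C D hCD μ ⟨hμ, hle⟩
    refine ⟨hμ, le_trans (b := μ.toSigned (G \ D.1)) hle ?_⟩
    obtain ⟨m, _, hm, -⟩ := exists_measure_of_nonneg (hM hμ)
    rw [hm _ (hG.sdiff D.2.1.isClosed).measurableSet, hm _ (hG.sdiff C.2.1.isClosed).measurableSet]
    exact measureReal_mono (sdiff_subset_sdiff_right hCD)
  -- The union of two compact subsets of `G` is again one, so the family `Z` is directed.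
  obtain ⟨μ, hμ⟩ := IsCompact.nonempty_iInter_of_directed_nonempty_isCompact_isClosed Z
    (fun C D => ⟨⟨C.1 ∪ D.1, C.2.1.union D.2.1, union_subset C.2.2 D.2.2⟩,
      hanti _ _ subset_union_left, hanti _ _ subset_union_right⟩)
    (fun C => h C.1 C.2.1 C.2.2) hcompact fun C => (hcompact C).isClosed
  rw [mem_iInter] at hμ
  obtain ⟨C, hC, hCG, hlt⟩ := μ.2 G hG.measurableSet ε hε
  have := (hμ ⟨C, hC, hCG⟩).2
  rw [mem_ofPred_eq, toSigned_diff μ hC.measurableSet hG.measurableSet hCG] at this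
  exact absurd ((le_abs_self _).trans_lt hlt) (not_lt.2 this)

end Compactness

end RadonWeak

theorem mainTheorem1 {T : Type*} [TopologicalSpace T] [T2Space T]
    [MeasurableSpace T] [BorelSpace T]
    (M : Set (RadonWeak.BoundedRadonMeasure T))
    (hM : M ⊆ RadonWeak.positiveRadonMeasures T) :
    (CompactSpace (closure M) ∧ T2Space (closure M)) ↔
      (RadonWeak.LocallyUniformlyTight M ∧ RadonWeak.UniformlyBoundedMass M) := by
  have hcl : closure M ⊆ RadonWeak.positiveRadonMeasures T :=
    closure_minimal hM RadonWeak.BoundedRadonMeasure.isClosed_positiveRadonMeasures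
  rw [← isCompact_iff_compactSpace]
  constructor
  · rintro ⟨hc, -⟩
    constructor
    · intro G hG ε hε
      obtain ⟨C, hC, hCG, hlt⟩ := RadonWeak.locallyUniformlyTight_of_isCompact hcl hc G hG ε hε
      exact ⟨C, hC, hCG, fun μ hμ => hlt μ (subset_closure hμ)⟩
    · obtain ⟨b, hb0, hb⟩ := RadonWeak.uniformlyBoundedMass_of_isCompact hc
      exact ⟨b, hb0, fun μ hμ => hb μ (subset_closure hμ)⟩
  · rintro ⟨ht, hb⟩
    exact ⟨RadonWeak.isCompact_of_isClosed_of_tight hcl isClosed_closure ht.closure hb.closure,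
      inferInstance⟩
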